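/- Let $X_1,X_2,\dots$ be independent and identically distributed random variables with values in $\mathbb{Z}_+=\{0,1,2,\dots\}$ whose distribution has infinite support. Write $P(i)=\mathbb{P}(X_1=i)$ and $\overline F(i)=\mathbb{P}(X_1>i)$, let $h_j=P(j)/\overline F(j-1)$ be the hazard rates, and for $\ell\ge j\ge 0$ let $h_{\ell\mid j}=P(\ell)/\overline F(j-1)$ (so $h_{j\mid j}=h_j$). Let $M_i=\max\{X_1,\dots,X_i\}$ and, for $m,\ell\in\mathbb{Z}_+$, put $$A_m^0=\mathbf 1_{\{X_1=m\}}+\sum_{i\ge 2}\mathbf 1_{\{X_i=m,\ M_{i-1}\le m\}},\qquad A_m^\ell=\sum_{i\ge 2}\mathbf 1_{\{X_i=m,\ M_{i-1}=m+\ell\}}\quad(\ell\ge 1),\qquad V_m^\ell=\sum_{p=0}^{\ell}A_m^p .$$ Then, for all $j,k\in\mathbb{Z}_+$, the random vector $(V_j^k,V_{j+1}^{k-1},\dots,V_{j+k}^0)$ has the multidimensional geometric distribution $\mathrm{Geom}^*(h_j,h_{j+1\mid j},\dots,h_{j+k\mid j})$. That is, these parameters lie in $[0,1)$, their sum is less than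 $1$, and for all $m_0,\dots,m_k\in\mathbb{Z}_+$ $$\mathbb{P}\bigl(V_j^k=m_0,\,V_{j+1}^{k-1}=m_1,\dots,V_{j+k}^0=m_k\bigr)=\Bigl(\prod_{i=0}^k h_{j+i\mid j}^{\,m_i}\Bigr)\Bigl(1-\sum_{i=0}^k h_{j+i\mid j}\Bigr)\frac{(m_0+\cdots+m_k)!}{m_0!\cdots m_k!}.$$ Moreover, almost surely, for every $n\ge 1$ such that the $n$-th record value $R_n$ satisfies $j+k\le R_n$, the vector $(V_j^k,\dots,V_{j+k}^0)$ coincides with the one computed from the sample of the first $n$ records and their near-records. Here the record times are $L_1=1$, $L_{i+1}=\min\{p>L_i: X_p>X_{L_i}\}$, and $R_i=X_{L_i}$; the near-records associated with $R_i$ are the $X_p$ with $L_i<p<L_{i+1}$ and $M_{p-1}-(k+1)<X_p\le M_{p-1}$, and $Y_i^1,\dots,Y_i^{S_i}$ denote their values; and the vector computed from the sample has the components $\sum_{p=0}^{k-i}\hat A_{j+i}^{p}$, $i=0,\dots,k$, where $$\hat A_m^0=\sum_{i=1}^n\Bigl(\mathbf 1_{\{R_i=m\}}+\sum_{q=1}^{S_i}\mathbf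 1_{\{R_i=m,\,Y_i^q=m\}}\Bigr),\qquad \hat A_m^\ell=\sum_{i=1}^n\sum_{q=1}^{S_i}\mathbf 1_{\{R_i=m+\ell,\,Y_i^q=m\}}\quad(\ell\ge1).$$ -/

import Mathlib

open MeasureTheory ProbabilityTheory

namespace DeltaRecord

noncomputable section

/-! ### The common distribution of the observations and its hazard rates -/

/-- `P(i) = ℙ(Y = i)`. -/
def pmf {Ω : Type*} [MeasurableSpace Ω] (μ : Measure Ω) (Y : Ω → ℕ) (i : ℕ) : ℝ :=
  μ.real {ω | Y ω = i}

/-- The survival function `F̄(i) = ℙ(Y > i)`, for an integer `i` (so that `F̄(-1)` makes sense). -/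
def survival {Ω : Type*} [MeasurableSpace Ω] (μ : Measure Ω) (Y : Ω → ℕ) (i : ℤ) : ℝ :=
  μ.real {ω | i < (Y ω : ℤ)}

/-- The hazard rate `h_j = P(j) / F̄(j - 1)`. -/
def hazard {Ω : Type*} [MeasurableSpace Ω] (μ : Measure Ω) (Y : Ω → ℕ) (j : ℕ) : ℝ :=
  pmf μ Y j / survival μ Y ((j : ℤ) - 1)

/-- The conditional hazard rate `h_{l | j} = P(l) / F̄(j - 1)`, used for `l ≥ j`. -/
def condHazard {Ω : Type*} [MeasurableSpace Ω] (μ : Measure Ω) (Y : Ω → ℕ) (l j : ℕ) : ℝ :=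
  pmf μ Y l / survival μ Y ((j : ℤ) - 1)

theorem condHazard_self {Ω : Type*} [MeasurableSpace Ω] (μ : Measure Ω) (Y : Ω → ℕ) (j : ℕ) :
    condHazard μ Y j j = hazard μ Y j := rfl

/-! ### Records and counts of `δ`-records, for a sequence of observations

A sequence `x 0, x 1, x 2, …` stands for the observations `X₁, X₂, X₃, …`; all times
(and the ranks of the records) are numbered from `0` instead of `1`. -/

/-- The maximum of the observations `x 0, …, x n`. -/
def partialMax (x : ℕ → ℕ) (n : ℕ) : ℕ := (Finset.range (n + 1)).sup x

/-- `Ã_m^l`, over the whole sequence. For `l = 0`: the number of times that the value `m` is a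
weak record. For `l ≥ 1`: the number of times that an observation equals `m` while the previous
maximum is `m + l`. The sums are taken in `ℕ∞`, where every series converges. -/
def tildeA (x : ℕ → ℕ) (l m : ℕ) : ℕ∞ :=
  if l = 0 then
    (if x 0 = m then 1 else 0) +
      ∑' i : ℕ, (if x (i + 1) = m ∧ partialMax x i ≤ m then 1 else 0)
  else
    ∑' i : ℕ, (if x (i + 1) = m ∧ partialMax x i = m + l then 1 else 0)

/-- `Ṽ_m^l = Ã_m^0 + ⋯ + Ã_m^l`. -/
def tildeV (x : ℕ → ℕ) (l m : ℕ) : ℕ∞ := ∑ i ∈ Finset.range (l + 1), tildeA x i m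

/-! ### The sample of the first `n` records and their near-records -/

/-- Record times: the first observation is a record, and the next record is the first later
observation that exceeds the present record. -/
def recordTime (x : ℕ → ℕ) : ℕ → ℕ
  | 0 => 0
  | n + 1 => sInf {i | recordTime x n < i ∧ x (recordTime x n) < x i}

/-- The value of the record of rank `n`. -/
def record (x : ℕ → ℕ) (n : ℕ) : ℕ := x (recordTime x n)

/-- The observation at time `i` is a near-record with parameter `a`:
`M_{i-1} - a < x_i ≤ M_{i-1}`. -/
def IsNearRecord (x : ℕ → ℕ) (a i : ℕ) : Prop :=
  1 ≤ i ∧ partialMax x (i - 1) < x i + a ∧ x i ≤ partialMax x (i - 1)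

open Classical in
/-- The times of the near-records with parameter `a` associated with the record of rank `n`. -/
def nearRecordTimes (x : ℕ → ℕ) (a n : ℕ) : Finset ℕ :=
  (Finset.Ioo (recordTime x n) (recordTime x (n + 1))).filter (fun i => IsNearRecord x a i)

/-- A sample `(r, s, y)`: the values of `n` records, for each of them the number of its
near-records, and the values of these near-records. -/
structure RecordSample (n : ℕ) where
  r : Fin n → ℕ
  s : Fin n → ℕ
  y : (i : Fin n) → Fin (s i) → ℕ

/-- The sample of the first `n` records and of the near-records, with parameter `k + 1`,
associated with each of them, in the order of their occurrence. -/
def observedSample (x : ℕ → ℕ) (k n : ℕ) : RecordSample n where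
  r i := record x i
  s i := (nearRecordTimes x (k + 1) i).card
  y i p := x ((nearRecordTimes x (k + 1) i).orderEmbOfFin rfl p)

/-- The count `a_m^l` computed from a sample. -/
def RecordSample.a {n : ℕ} (t : RecordSample n) (l m : ℕ) : ℕ :=
  if l = 0 then
    ∑ i : Fin n, ((if t.r i = m then 1 else 0) +
      ∑ p : Fin (t.s i), (if t.r i = m ∧ t.y i p = m then 1 else 0))
  else
    ∑ i : Fin n, ∑ p : Fin (t.s i), (if t.r i = m + l ∧ t.y i p = m then 1 else 0)

/-- The count `v_m^l = a_m^0 + ⋯ + a_m^l` computed from a sample. -/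
def RecordSample.v {n : ℕ} (t : RecordSample n) (l m : ℕ) : ℕ :=
  ∑ i ∈ Finset.range (l + 1), t.a i m

/-! ### The multidimensional geometric distribution -/

/-- The random vector `Z` has the multidimensional geometric distribution `Geom*(π_1, …, π_d)`.
Components with values in `ℕ∞` are allowed; the mass function, being that of a probability on
`ℕ^d`, says in particular that they are almost surely finite. -/
structure IsGeomStar {Ω : Type*} [MeasurableSpace Ω] (μ : Measure Ω) {d : ℕ}
    (Z : Ω → Fin d → ℕ∞) (π : Fin d → ℝ) : Prop where
  measurable : Measurable Z
  param_nonneg : ∀ i, 0 ≤ π i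
  param_lt_one : ∀ i, π i < 1
  sum_lt_one : ∑ i, π i < 1
  mass : ∀ m : Fin d → ℕ, μ.real {ω | ∀ i, Z ω i = (m i : ℕ∞)} =
    (∏ i, π i ^ m i) * (1 - ∑ i, π i) * (Nat.multinomial Finset.univ m : ℝ)

end

end DeltaRecord

namespace DeltaRecord

/-! ### Counting series with values in `ℕ∞` -/

/-! The level `m + l` equals `j + k` for every component of the vector, and `tildeV x l m` counts
the times at which `m` occurs while all earlier observations are at most `m + l`
(`tildeV_eq_visits`). So the vector counts the occurrences of `j, …, j + k` before an observation
exceeds `j + k`. Values below `j` change nothing; conditionally on being at least `j`, an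
observation equals `j + i` with probability `h_{j+i|j}` and otherwise stops the count. The
multinomial coefficient counts the orders of the visits. Formally, conditioning on the first
observation gives a recursion for the mass function (`visitsMass_mul_survival`), which the
multinomial coefficients match (`multinomial_eq_sum_update`). For the sample, almost sure
unboundedness makes all record times genuine. They cut time into blocks on which the running maximum
is the current record, and a block's visits are its record or near-records
(`sum_nearRecordTimes_eq`). -/

theorem tsum_ite_one_eq_encard (p : ℕ → Prop) [DecidablePred p] :
    ∑' i, (if p i then (1 : ℕ∞) else 0) = {i | p i}.encard := by
  have hsum : HasSum (fun i => if p i then (1 : ℕ∞) else 0)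
      (⨆ s : Finset ℕ, ∑ i ∈ s, if p i then (1 : ℕ∞) else 0) :=
    tendsto_atTop_iSup fun s t h => Finset.sum_le_sum_of_subset h
  rw [hsum.tsum_eq]
  simp only [Finset.sum_boole]
  apply le_antisymm
  · refine iSup_le fun s => ?_
    rw [← Set.encard_coe_eq_coe_finsetCard]
    exact Set.encard_le_encard fun i hi => (Finset.mem_filter.1 hi).2
  · by_cases hfin : {i | p i}.Finite
    · refine le_iSup_of_le hfin.toFinset ?_
      rw [hfin.encard_eq_coe_toFinset_card, Nat.cast_le]
      exact Finset.card_le_card fun i hi => Finset.mem_filter.2 ⟨hi, by simpa using hi⟩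
    · rw [Set.Infinite.encard_eq hfin, top_le_iff, ENat.eq_top_iff_forall_ge]
      intro n
      obtain ⟨t, ht, hcard⟩ := Set.Infinite.exists_subset_card_eq hfin n
      refine le_iSup_of_le t ?_
      have hp : ∀ i ∈ t, p i := fun i hi => ht hi
      rw [Finset.filter_true_of_mem hp, hcard]

theorem encard_eq_ite_add_encard_succ (s : Set ℕ) [Decidable (0 ∈ s)] :
    s.encard = (if 0 ∈ s then 1 else 0) + {i | i + 1 ∈ s}.encard := by
  have himage : s \ {0} = Nat.succ '' {i | i + 1 ∈ s} := by
    ext t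
    cases t <;> simp
  rw [← Nat.succ_injective.encard_image {i | i + 1 ∈ s}, ← himage]
  split_ifs with h
  · rw [add_comm, Set.encard_sdiff_singleton_add_one h]
  · rw [Set.sdiff_singleton_eq_self h, zero_add]

/-! ### Visits to a value before a level is exceeded -/

/-- The number of visits to `m` at times before which all observations are at most `c`. -/
noncomputable def visits (x : ℕ → ℕ) (c m : ℕ) : ℕ∞ :=
  {t | x t = m ∧ ∀ s < t, x s ≤ c}.encard

theorem partialMax_le_iff (x : ℕ → ℕ) (n c : ℕ) :
    partialMax x n ≤ c ↔ ∀ s < n + 1, x s ≤ c := by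
  simp [partialMax]

/-- The events that the previous maximum is at most `m`, or equals `m + p` for some `1 ≤ p ≤ l`, are
disjoint with union "at most `m + l`". -/
theorem tildeV_eq_visits (x : ℕ → ℕ) (l m : ℕ) : tildeV x l m = visits x (m + l) m := by
  rw [visits, encard_eq_ite_add_encard_succ]
  simp only [Set.mem_ofPred_eq, ← partialMax_le_iff, not_lt_zero, false_imp_iff, implies_true,
    and_true]
  induction l with
  | zero => simp [tildeV, tildeA, tsum_ite_one_eq_encard]
  | succ l ih =>
    rw [tildeV, Finset.sum_range_succ, ← tildeV, ih, tildeA, if_neg (Nat.succ_ne_zero l),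
      tsum_ite_one_eq_encard, add_assoc, ← Set.encard_union_eq]
    · congr 2
      ext i
      simp only [Set.mem_union, Set.mem_ofPred_eq]
      omega
    · rw [Set.disjoint_left]
      rintro i ⟨_, h⟩ ⟨_, h'⟩
      omega

theorem visits_eq_of_le (x : ℕ → ℕ) {c : ℕ} (m : ℕ) (h : x 0 ≤ c) :
    visits x c m = (if x 0 = m then 1 else 0) + visits (fun n => x (n + 1)) c m := by
  rw [visits, encard_eq_ite_add_encard_succ, visits]
  simp only [Set.mem_ofPred_eq, not_lt_zero, false_imp_iff, implies_true, and_true]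
  congr 3
  ext i
  refine and_congr_right fun _ => ⟨fun H s hs => H (s + 1) (by omega), fun H s hs => ?_⟩
  cases s with
  | zero => exact h
  | succ s => exact H s (by omega)

theorem visits_eq_zero_of_lt (x : ℕ → ℕ) {c m : ℕ} (h : c < x 0) (hm : m ≤ c) :
    visits x c m = 0 := by
  rw [visits, Set.encard_eq_zero, Set.eq_empty_iff_forall_notMem]
  rintro t ⟨ht, H⟩
  rcases Nat.eq_zero_or_pos t with rfl | hpos
  · omega
  · exact absurd (H 0 hpos) (by omega)

theorem measurable_visits (c m : ℕ) : Measurable fun x : ℕ → ℕ => visits x c m := by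
  refine measurable_encard.comp (measurable_set_iff.2 fun t => ?_)
  refine measurableSet_setOfPred.1 ?_
  change MeasurableSet {x : ℕ → ℕ | x t = m ∧ ∀ s < t, x s ≤ c}
  measurability

/-- Pascal's rule. After multiplication by `∏ i, (m i)!`, the `i`-th term is `m i * (|m| - 1)!`, and
these add up to `|m|!`. -/
theorem multinomial_eq_sum_update {d : ℕ} (m : Fin d → ℕ) (hm : m ≠ 0) :
    Nat.multinomial Finset.univ m = ∑ i, if 1 ≤ m i then
      Nat.multinomial Finset.univ (Function.update m i (m i - 1)) else 0 := by
  have hpos : 0 < ∏ i, (m i).factorial := Finset.prod_pos fun i _ => Nat.factorial_pos _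
  apply Nat.eq_of_mul_eq_mul_left hpos
  rw [Nat.multinomial_spec, Finset.mul_sum]
  obtain ⟨n, hn⟩ : ∃ n, ∑ i, m i = n + 1 := by
    refine Nat.exists_eq_succ_of_ne_zero fun h => hm (funext fun i => ?_)
    exact Finset.sum_eq_zero_iff.1 h i (Finset.mem_univ i)
  have hterm : ∀ i, (∏ i, (m i).factorial) * (if 1 ≤ m i then
      Nat.multinomial Finset.univ (Function.update m i (m i - 1)) else 0)
      = m i * n.factorial := by
    intro i
    split_ifs with hi
    · have hs := Nat.multinomial_spec Finset.univ (Function.update m i (m i - 1))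
      rw [← Finset.mul_prod_erase _ _ (Finset.mem_univ i),
        Finset.prod_congr rfl fun b hb => by
          rw [Function.update_of_ne (Finset.ne_of_mem_erase hb)],
        Finset.sum_update_of_mem (Finset.mem_univ i)] at hs
      rw [← Finset.add_sum_erase _ _ (Finset.mem_univ i)] at hn
      rw [Finset.sdiff_singleton_eq_erase, Function.update_self,
        show m i - 1 + ∑ b ∈ Finset.univ.erase i, m b = n by omega] at hs
      rw [← Finset.mul_prod_erase _ _ (Finset.mem_univ i), ← hs,
        ← Nat.mul_factorial_pred (by omega : m i ≠ 0)]
      ring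
    · simp [show m i = 0 by omega]
  rw [Finset.sum_congr rfl fun i _ => hterm i, ← Finset.sum_mul, hn, Nat.factorial_succ]

theorem forall_visits_eq_iff_of_eq (x : ℕ → ℕ) (j k : ℕ) (m : Fin (k + 1) → ℕ)
    (i : Fin (k + 1)) (h : x 0 = j + i) :
    (∀ a : Fin (k + 1), visits x (j + k) (j + a) = m a) ↔
      1 ≤ m i ∧ ∀ a : Fin (k + 1), visits (fun n => x (n + 1)) (j + k) (j + a) =
        (Function.update m i (m i - 1) a : ℕ) := by
  have hle : x 0 ≤ j + k := by omega
  -- The guard `1 ≤ m i` is needed because `m i - 1` truncates at zero.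
  have key : visits x (j + k) (j + i) = m i ↔
      1 ≤ m i ∧ visits (fun n => x (n + 1)) (j + k) (j + i) = (m i - 1 : ℕ) := by
    rw [visits_eq_of_le x _ hle, if_pos h]
    induction visits (fun n => x (n + 1)) (j + k) (j + i) using ENat.recTopCoe with
    | top => exact iff_of_false (by simp) fun h => ENat.top_ne_natCast _ h.2
    | coe a => norm_cast; omega
  have hne : ∀ a, a ≠ i → visits x (j + k) (j + a) =
      visits (fun n => x (n + 1)) (j + k) (j + a) := by
    intro a ha
    rw [visits_eq_of_le x _ hle, if_neg fun h' => ha (Fin.ext (by omega)), zero_add]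
  constructor
  · intro H
    refine ⟨(key.1 (H i)).1, fun a => ?_⟩
    rcases eq_or_ne a i with rfl | ha
    · rw [Function.update_self, (key.1 (H a)).2]
    · rw [Function.update_of_ne ha, ← hne a ha, H a]
  · rintro ⟨h1, H⟩ a
    rcases eq_or_ne a i with rfl | ha
    · exact key.2 ⟨h1, by rw [H a, Function.update_self]⟩
    · rw [hne a ha, H a, Function.update_of_ne ha]

/-! ### Conditioning on the first observation -/

section Probability

variable {Ω : Type*} [MeasurableSpace Ω] {μ : Measure Ω} {X : ℕ → Ω → ℕ}

theorem map_tail_eq_map (hmeas : ∀ n, Measurable (X n)) (hindep : iIndepFun X μ)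
    (hident : ∀ n, IdentDistrib (X n) (X 0) μ μ) :
    μ.map (fun ω n => X (n + 1) ω) = μ.map (fun ω n => X n ω) := by
  rw [hindep.map_fun_eq_infinitePi_map hmeas,
    (hindep.precomp (add_left_injective 1)).map_fun_eq_infinitePi_map fun n => hmeas (n + 1)]
  congr 1
  funext n
  rw [(hident (n + 1)).map_eq, (hident n).map_eq]

/-- The σ-algebras generated by the indices `{0}` and `{0}ᶜ` are independent, and the shifted
sequence has the law of the original one. -/
theorem measureReal_head_inter_tail (hmeas : ∀ n, Measurable (X n)) (hindep : iIndepFun X μ)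
    (hident : ∀ n, IdentDistrib (X n) (X 0) μ μ) (A : Set ℕ) {E : Set (ℕ → ℕ)}
    (hE : MeasurableSet E) :
    μ.real {ω | X 0 ω ∈ A ∧ (fun n => X (n + 1) ω) ∈ E} =
      μ.real {ω | X 0 ω ∈ A} * μ.real {ω | (fun n => X n ω) ∈ E} := by
  have hind := indep_iSup_of_disjoint (fun n => (hmeas n).comap_le) hindep.iIndep
    (S := {0}) (T := {0}ᶜ) disjoint_compl_right
  have hhead : MeasurableSet[⨆ i ∈ ({0} : Set ℕ), MeasurableSpace.comap (X i) inferInstance]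
      {ω | X 0 ω ∈ A} :=
    le_iSup₂_of_le (f := fun i (_ : i ∈ ({0} : Set ℕ)) =>
      MeasurableSpace.comap (X i) inferInstance) 0 rfl le_rfl _ ⟨A, .of_discrete, rfl⟩
  have htail : MeasurableSet[⨆ i ∈ ({0} : Set ℕ)ᶜ, MeasurableSpace.comap (X i) inferInstance]
      {ω | (fun n => X (n + 1) ω) ∈ E} := by
    refine @measurable_pi_iff Ω ℕ (fun _ => ℕ) (⨆ i ∈ ({0} : Set ℕ)ᶜ,
      MeasurableSpace.comap (X i) inferInstance) _ (fun ω n => X (n + 1) ω) |>.2 (fun n => ?_) hE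
    exact measurable_iff_comap_le.2 (le_iSup₂_of_le (f := fun i (_ : i ∈ ({0} : Set ℕ)ᶜ) =>
      MeasurableSpace.comap (X i) inferInstance) (n + 1) (Nat.succ_ne_zero n) le_rfl)
  have hlaw : μ {ω | (fun n => X (n + 1) ω) ∈ E} = μ {ω | (fun n => X n ω) ∈ E} := by
    have := congrArg (fun ν => ν E) (map_tail_eq_map hmeas hindep hident)
    rwa [Measure.map_apply (measurable_pi_lambda _ fun n => hmeas (n + 1)) hE,
      Measure.map_apply (measurable_pi_lambda _ hmeas) hE] at this
  have := Indep_iff _ _ μ |>.1 hind _ _ hhead htail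
  rw [hlaw] at this
  simp only [measureReal_def, ← ENNReal.toReal_mul, ← this]
  rfl

variable [IsProbabilityMeasure μ]

theorem measureReal_eq_add_sum_add {Y : Ω → ℕ} (hY : Measurable Y) (j k : ℕ) {S : Set Ω}
    (hS : MeasurableSet S) :
    μ.real S = μ.real {ω | Y ω < j ∧ ω ∈ S} +
      ∑ i : Fin (k + 1), μ.real {ω | Y ω = j + i ∧ ω ∈ S} + μ.real {ω | j + k < Y ω ∧ ω ∈ S} := by
  have hm : ∀ A : Set ℕ, MeasurableSet {ω | Y ω ∈ A ∧ ω ∈ S} := fun A =>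
    (hY (.of_discrete : MeasurableSet A)).inter hS
  have h1 : μ.real (⋃ i ∈ (Finset.univ : Finset (Fin (k + 1))), {ω | Y ω = j + i ∧ ω ∈ S}) =
      ∑ i : Fin (k + 1), μ.real {ω | Y ω = j + i ∧ ω ∈ S} := by
    refine measureReal_biUnion_finset ?_ fun i _ => hm {j + i}
    intro a _ b _ hab
    refine Set.disjoint_left.2 ?_
    rintro ω ⟨ha, _⟩ ⟨hb, _⟩
    exact hab (Fin.ext (by omega))
  rw [← h1, ← measureReal_union (h₂ := measure_ne_top _ _),
    ← measureReal_union (h₂ := measure_ne_top _ _)]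
  · congr 1
    ext ω
    simp only [Set.mem_union, Set.mem_ofPred_eq, Set.mem_iUnion, Finset.mem_univ, exists_true_left]
    constructor
    · intro h
      rcases lt_or_ge (Y ω) j with h1 | h1
      · exact .inl (.inl ⟨h1, h⟩)
      · rcases lt_or_ge (j + k) (Y ω) with h2 | h2
        · exact .inr ⟨h2, h⟩
        · exact .inl (.inr ⟨⟨Y ω - j, by omega⟩, by simp only; omega, h⟩)
    · rintro ((⟨_, h⟩ | ⟨_, _, h⟩) | ⟨_, h⟩) <;> exact h
  · refine Set.disjoint_left.2 ?_
    rintro ω h ⟨h2, _⟩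
    simp only [Set.mem_union, Set.mem_ofPred_eq, Set.mem_iUnion, Finset.mem_univ,
      exists_true_left] at h
    rcases h with ⟨h, _⟩ | ⟨i, h, _⟩ <;> omega
  · exact hm (Set.Ioi (j + k))
  · refine Set.disjoint_left.2 ?_
    rintro ω ⟨h, _⟩ h2
    simp only [Set.mem_ofPred_eq, Set.mem_iUnion, Finset.mem_univ, exists_true_left] at h2
    obtain ⟨i, h2, _⟩ := h2
    omega
  · exact Finset.measurableSet_biUnion _ fun i _ => hm {j + i}

theorem survival_sub_one_eq {Y : Ω → ℕ} (hY : Measurable Y) (j k : ℕ) :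
    survival μ Y ((j : ℤ) - 1) =
      ∑ i : Fin (k + 1), pmf μ Y (j + i) + μ.real {ω | j + k < Y ω} := by
  have hset : {ω | (j : ℤ) - 1 < (Y ω : ℤ)} = {ω | j ≤ Y ω} := by
    ext ω
    simp only [Set.mem_ofPred_eq]
    omega
  have hmeas : MeasurableSet {ω | j ≤ Y ω} := hY (.of_discrete : MeasurableSet (Set.Ici j))
  rw [survival, hset, measureReal_eq_add_sum_add hY j k hmeas]
  have h0 : {ω | Y ω < j ∧ ω ∈ {ω | j ≤ Y ω}} = ∅ := by
    ext ω
    simp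
  have h1 : ∀ i : Fin (k + 1), {ω | Y ω = j + i ∧ ω ∈ {ω | j ≤ Y ω}} = {ω | Y ω = j + i} := by
    intro i
    ext ω
    simp only [Set.mem_ofPred_eq]
    omega
  have h2 : {ω | j + k < Y ω ∧ ω ∈ {ω | j ≤ Y ω}} = {ω | j + k < Y ω} := by
    ext ω
    simp only [Set.mem_ofPred_eq]
    omega
  simp only [h0, h1, h2, measureReal_empty, zero_add, pmf]

theorem measureReal_lt_add_survival {Y : Ω → ℕ} (hY : Measurable Y) (j : ℕ) :
    μ.real {ω | Y ω < j} + survival μ Y ((j : ℤ) - 1) = 1 := by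
  have hset : {ω | (j : ℤ) - 1 < (Y ω : ℤ)} = {ω | Y ω < j}ᶜ := by
    ext ω
    simp only [Set.mem_ofPred_eq, Set.mem_compl_iff]
    omega
  rw [survival, hset]
  exact probReal_add_probReal_compl (hY (.of_discrete : MeasurableSet (Set.Iio j)))

theorem measureReal_lt_pos {Y : Ω → ℕ} (hsupp : {i : ℕ | pmf μ Y i ≠ 0}.Infinite) (c : ℕ) :
    0 < μ.real {ω | c < Y ω} := by
  obtain ⟨i, hi, hlt⟩ := hsupp.exists_gt c
  refine lt_of_lt_of_le (lt_of_le_of_ne measureReal_nonneg (Ne.symm hi)) (measureReal_mono ?_)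
  rintro ω rfl
  exact hlt

/-- If `q` is the probability that all observations are at most `c`, splitting off the first gives
`q = ℙ(X 0 ≤ c) * q`; infinite support makes the factor less than one, so `q = 0`. -/
theorem ae_exists_lt (hmeas : ∀ n, Measurable (X n)) (hindep : iIndepFun X μ)
    (hident : ∀ n, IdentDistrib (X n) (X 0) μ μ)
    (hsupp : {i : ℕ | pmf μ (X 0) i ≠ 0}.Infinite) :
    ∀ᵐ ω ∂μ, ∀ c, ∃ t, c < X t ω := by
  rw [ae_all_iff]
  intro c
  have hE : MeasurableSet {x : ℕ → ℕ | ∀ n, x n ≤ c} := by measurability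
  have h := measureReal_head_inter_tail hmeas hindep hident {a | a ≤ c} hE
  have hset : {ω | X 0 ω ∈ {a | a ≤ c} ∧ (fun n => X (n + 1) ω) ∈ {x : ℕ → ℕ | ∀ n, x n ≤ c}} =
      {ω | (fun n => X n ω) ∈ {x : ℕ → ℕ | ∀ n, x n ≤ c}} := by
    ext ω
    exact ⟨fun ⟨h0, h1⟩ n => by cases n; exacts [h0, h1 _], fun H => ⟨H 0, fun n => H (n + 1)⟩⟩
  rw [hset] at h
  have hlt : μ.real {ω | X 0 ω ∈ {a | a ≤ c}} < 1 := by
    have hc : {ω | c < X 0 ω} = {ω | X 0 ω ∈ {a | a ≤ c}}ᶜ := by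
      ext ω
      simp
    have hpos := measureReal_lt_pos hsupp c
    rw [hc] at hpos
    have := probReal_add_probReal_compl (μ := μ)
      (hmeas 0 (.of_discrete : MeasurableSet {a | a ≤ c}))
    change μ.real {ω | X 0 ω ∈ {a | a ≤ c}} + _ = 1 at this
    change 0 < μ.real (X 0 ⁻¹' {a | a ≤ c})ᶜ at hpos
    linarith
  have hzero : μ.real {ω | (fun n => X n ω) ∈ {x : ℕ → ℕ | ∀ n, x n ≤ c}} = 0 := by
    have h0 : (0 : ℝ) ≤ μ.real {ω | (fun n => X n ω) ∈ {x : ℕ → ℕ | ∀ n, x n ≤ c}} :=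
      measureReal_nonneg
    nlinarith
  rw [ae_iff]
  have := (measureReal_eq_zero_iff).1 hzero
  simpa using this

/-- The probability that the numbers of visits to `j, …, j + k` before the observations exceed
`j + k` are given by `m`. -/
noncomputable def visitsMass (μ : Measure Ω) (X : ℕ → Ω → ℕ) (j k : ℕ) (m : Fin (k + 1) → ℕ) : ℝ :=
  μ.real {ω | ∀ i : Fin (k + 1), visits (fun n => X n ω) (j + k) (j + i) = m i}

/-- First-step analysis: a value below `j` restarts the same problem, the value `j + i` uses up one
visit, and a value above `j + k` ends the count. The restart term moves to the left, where `1 - ℙ(X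
0 < j)` is the survival factor. -/
theorem visitsMass_mul_survival (hmeas : ∀ n, Measurable (X n)) (hindep : iIndepFun X μ)
    (hident : ∀ n, IdentDistrib (X n) (X 0) μ μ) (j k : ℕ) (m : Fin (k + 1) → ℕ) :
    visitsMass μ X j k m * survival μ (X 0) ((j : ℤ) - 1) =
      ∑ i : Fin (k + 1), pmf μ (X 0) (j + i) *
        (if 1 ≤ m i then visitsMass μ X j k (Function.update m i (m i - 1)) else 0) +
      μ.real {ω | j + k < X 0 ω} * (if m = 0 then 1 else 0) := by
  have hE : ∀ m : Fin (k + 1) → ℕ, MeasurableSet {x : ℕ → ℕ | ∀ i : Fin (k + 1),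
      visits x (j + k) (j + i) = m i} := by
    intro m
    rw [Set.ofPred_forall]
    exact .iInter fun i => measurable_visits (j + k) (j + i) (measurableSet_singleton _)
  have hX : Measurable fun ω n => X n ω := measurable_pi_lambda _ hmeas
  have hdec := measureReal_eq_add_sum_add (μ := μ) (hmeas 0) j k (hX (hE m))
  have h0 := measureReal_head_inter_tail hmeas hindep hident (Set.Iio j) (hE m)
  have hset0 : {ω | X 0 ω < j ∧ ω ∈ (fun ω n => X n ω) ⁻¹' {x : ℕ → ℕ | ∀ i : Fin (k + 1),
      visits x (j + k) (j + i) = m i}} = {ω | X 0 ω ∈ Set.Iio j ∧ (fun n => X (n + 1) ω) ∈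
        {x : ℕ → ℕ | ∀ i : Fin (k + 1), visits x (j + k) (j + i) = m i}} := by
    ext ω
    refine and_congr_right fun h => forall_congr' fun i => ?_
    rw [visits_eq_of_le (fun n => X n ω) _ (by omega), if_neg (by omega), zero_add]
  have h1 : ∀ i : Fin (k + 1), μ.real {ω | X 0 ω = j + i ∧ ω ∈ (fun ω n => X n ω) ⁻¹'
      {x : ℕ → ℕ | ∀ i : Fin (k + 1), visits x (j + k) (j + i) = m i}} = pmf μ (X 0) (j + i) *
        (if 1 ≤ m i then visitsMass μ X j k (Function.update m i (m i - 1)) else 0) := by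
    intro i
    split_ifs with hi
    · refine Eq.trans ?_ (measureReal_head_inter_tail hmeas hindep hident {j + (i : ℕ)}
        (hE (Function.update m i (m i - 1))))
      congr 1
      ext ω
      refine and_congr_right fun h => ?_
      exact (forall_visits_eq_iff_of_eq (fun n => X n ω) j k m i h).trans (and_iff_right hi)
    · rw [mul_zero, ← measureReal_empty (μ := μ)]
      congr 1
      ext ω
      simp only [Set.mem_ofPred_eq, Set.mem_empty_iff_false, iff_false]
      rintro ⟨h, H⟩
      exact hi ((forall_visits_eq_iff_of_eq (fun n => X n ω) j k m i h).1 H).1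
  have h2 : μ.real {ω | j + k < X 0 ω ∧ ω ∈ (fun ω n => X n ω) ⁻¹'
      {x : ℕ → ℕ | ∀ i : Fin (k + 1), visits x (j + k) (j + i) = m i}} =
      μ.real {ω | j + k < X 0 ω} * (if m = 0 then 1 else 0) := by
    have hz : ∀ ω, j + k < X 0 ω → ∀ i : Fin (k + 1),
        visits (fun n => X n ω) (j + k) (j + i) = 0 := fun ω h i =>
      visits_eq_zero_of_lt _ h (by omega)
    split_ifs with hm
    · rw [mul_one]
      congr 1
      ext ω
      exact and_iff_left_of_imp fun h i => by simp [hz ω h i, hm]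
    · rw [mul_zero, ← measureReal_empty (μ := μ)]
      congr 1
      ext ω
      simp only [Set.mem_ofPred_eq, Set.mem_empty_iff_false, iff_false]
      rintro ⟨h, H⟩
      refine hm (funext fun i => ?_)
      have := H i
      rw [hz ω h i] at this
      exact_mod_cast this.symm
  rw [hset0, h0, Finset.sum_congr rfl fun i _ => h1 i, h2] at hdec
  have hr := measureReal_lt_add_survival (μ := μ) (hmeas 0) j
  change visitsMass μ X j k m = μ.real {ω | X 0 ω < j} * visitsMass μ X j k m + _ + _ at hdec
  linear_combination hdec + visitsMass μ X j k m * hr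

theorem visitsMass_eq (hmeas : ∀ n, Measurable (X n)) (hindep : iIndepFun X μ)
    (hident : ∀ n, IdentDistrib (X n) (X 0) μ μ) (j k : ℕ)
    (hS : survival μ (X 0) ((j : ℤ) - 1) ≠ 0) (m : Fin (k + 1) → ℕ) :
    visitsMass μ X j k m = (∏ i : Fin (k + 1), condHazard μ (X 0) (j + i) j ^ m i) *
      (1 - ∑ i : Fin (k + 1), condHazard μ (X 0) (j + i) j) *
        (Nat.multinomial Finset.univ m : ℝ) := by
  have hp : ∀ i : Fin (k + 1), pmf μ (X 0) (j + i) =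
      condHazard μ (X 0) (j + i) j * survival μ (X 0) ((j : ℤ) - 1) := fun i =>
    (div_mul_cancel₀ _ hS).symm
  have hq : μ.real {ω | j + k < X 0 ω} = (1 - ∑ i : Fin (k + 1),
      condHazard μ (X 0) (j + i) j) * survival μ (X 0) ((j : ℤ) - 1) := by
    have := survival_sub_one_eq (μ := μ) (hmeas 0) j k
    rw [Finset.sum_congr rfl fun i _ => hp i, ← Finset.sum_mul] at this
    linarith
  -- Each visit used up lowers the total by one, so the recursion determines the mass function.
  induction hn : ∑ i, m i generalizing m with
  | zero =>
    obtain rfl : m = 0 := funext fun i => Finset.sum_eq_zero_iff.1 hn i (Finset.mem_univ i)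
    have h := visitsMass_mul_survival hmeas hindep hident j k 0
    rw [hq] at h
    apply mul_right_cancel₀ hS
    simpa [Nat.multinomial] using h
  | succ n ih =>
    have hm : m ≠ 0 := by
      rintro rfl
      simp at hn
    have h := visitsMass_mul_survival hmeas hindep hident j k m
    rw [if_neg hm, mul_zero, add_zero] at h
    apply mul_right_cancel₀ hS
    rw [h, multinomial_eq_sum_update m hm, Nat.cast_sum, Finset.mul_sum, Finset.sum_mul]
    refine Finset.sum_congr rfl fun i _ => ?_
    split_ifs with hi
    · have hsum : ∑ a, Function.update m i (m i - 1) a = n := by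
        rw [← Finset.add_sum_erase _ _ (Finset.mem_univ i)] at hn
        rw [Finset.sum_update_of_mem (Finset.mem_univ i), Finset.sdiff_singleton_eq_erase]
        omega
      have hprod : ∏ a : Fin (k + 1), condHazard μ (X 0) (j + a) j ^ m a =
          condHazard μ (X 0) (j + i) j * ∏ a : Fin (k + 1), condHazard μ (X 0) (j + a) j ^
            Function.update m i (m i - 1) a := by
        rw [← Finset.mul_prod_erase _ _ (Finset.mem_univ i),
          ← Finset.mul_prod_erase (a := i) _ (fun a : Fin (k + 1) =>
            condHazard μ (X 0) (j + a) j ^ Function.update m i (m i - 1) a) (Finset.mem_univ i),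
          ← mul_assoc, Function.update_self, ← pow_succ', Nat.sub_add_cancel hi]
        congr 1
        refine Finset.prod_congr rfl fun b hb => ?_
        rw [Function.update_of_ne (Finset.ne_of_mem_erase hb)]
      rw [ih _ hsum, hprod, hp i]
      ring
    · simp

theorem isGeomStar_tildeV (hmeas : ∀ n, Measurable (X n)) (hindep : iIndepFun X μ)
    (hident : ∀ n, IdentDistrib (X n) (X 0) μ μ)
    (hsupp : {i : ℕ | pmf μ (X 0) i ≠ 0}.Infinite) (j k : ℕ) :
    IsGeomStar μ
      (fun ω (i : Fin (k + 1)) => tildeV (fun n => X n ω) (k - (i : ℕ)) (j + (i : ℕ)))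
      (fun i : Fin (k + 1) => condHazard μ (X 0) (j + (i : ℕ)) j) := by
  have hV : ∀ ω, ∀ i : Fin (k + 1), tildeV (fun n => X n ω) (k - (i : ℕ)) (j + (i : ℕ)) =
      visits (fun n => X n ω) (j + k) (j + i) := by
    intro ω i
    rw [tildeV_eq_visits]
    congr 1
    omega
  have hq := measureReal_lt_pos hsupp (j + k)
  have hsurv := survival_sub_one_eq (μ := μ) (hmeas 0) j k
  have hp : ∀ i : Fin (k + 1), 0 ≤ pmf μ (X 0) (j + i) := fun i => measureReal_nonneg
  -- The tail beyond `j + k` has positive mass; this also makes the parameters sum to less than one.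
  have hS : 0 < survival μ (X 0) ((j : ℤ) - 1) := by
    have := Finset.sum_nonneg fun i (_ : i ∈ Finset.univ) => hp i
    linarith
  have hnonneg : ∀ i : Fin (k + 1), 0 ≤ condHazard μ (X 0) (j + i) j := fun i =>
    div_nonneg (hp i) hS.le
  have hsum : ∑ i : Fin (k + 1), condHazard μ (X 0) (j + i) j < 1 := by
    simp only [condHazard]
    rw [← Finset.sum_div, div_lt_one hS]
    linarith
  refine ⟨?_, hnonneg, fun i => ?_, hsum, fun m => ?_⟩
  · simp only [hV]
    exact measurable_pi_lambda _ fun i =>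
      (measurable_visits (j + k) (j + i)).comp (measurable_pi_lambda _ hmeas)
  · exact (Finset.single_le_sum (fun a _ => hnonneg a) (Finset.mem_univ i)).trans_lt hsum
  · simp only [hV]
    exact visitsMass_eq hmeas hindep hident j k hS.ne' m

end Probability

/-! ### Records of an unbounded sequence -/

section Records

variable {x : ℕ → ℕ}

/-- Unboundedness rules out the default `sInf ∅ = 0`: a value above the current record exists, and
it must come later since all earlier values are smaller. -/
theorem recordTime_succ_mem (hx : ∀ c, ∃ t, c < x t) {n : ℕ}
    (h : ∀ s < recordTime x n, x s < x (recordTime x n)) :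
    recordTime x n < recordTime x (n + 1) ∧
      x (recordTime x n) < x (recordTime x (n + 1)) := by
  obtain ⟨t, ht⟩ := hx (x (recordTime x n))
  refine Nat.sInf_mem (s := {i | recordTime x n < i ∧ x (recordTime x n) < x i}) ⟨t, ?_, ht⟩
  by_contra! hle
  rcases hle.lt_or_eq with hlt | rfl
  · exact lt_asymm ht (h t hlt)
  · exact lt_irrefl _ ht

theorem le_of_lt_recordTime_succ {n : ℕ}
    (h : ∀ s < recordTime x n, x s < x (recordTime x n)) {s : ℕ}
    (hs : s < recordTime x (n + 1)) : x s ≤ x (recordTime x n) := by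
  rcases lt_trichotomy s (recordTime x n) with h1 | rfl | h1
  · exact (h s h1).le
  · exact le_rfl
  · by_contra! h2
    exact Nat.notMem_of_lt_sInf hs ⟨h1, h2⟩

theorem lt_of_lt_recordTime (hx : ∀ c, ∃ t, c < x t) (n : ℕ) :
    ∀ s < recordTime x n, x s < x (recordTime x n) := by
  induction n with
  | zero => exact fun s hs => absurd hs (Nat.not_lt_zero s)
  | succ n ih =>
    exact fun s hs => (le_of_lt_recordTime_succ ih hs).trans_lt (recordTime_succ_mem hx ih).2

theorem partialMax_eq_of_mem_Ioo (hx : ∀ c, ∃ t, c < x t) {n t : ℕ}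
    (ht : t ∈ Finset.Ioo (recordTime x n) (recordTime x (n + 1))) :
    partialMax x (t - 1) = x (recordTime x n) := by
  rw [Finset.mem_Ioo] at ht
  apply le_antisymm
  · rw [partialMax_le_iff]
    exact fun s hs => le_of_lt_recordTime_succ (lt_of_lt_recordTime hx n) (by omega)
  · exact Finset.le_sup (Finset.mem_range.2 (by omega))

theorem sum_range_sum_Ico_recordTime (hx : ∀ c, ∃ t, c < x t) (f : ℕ → ℕ) (n : ℕ) :
    ∑ q ∈ Finset.range n, ∑ t ∈ Finset.Ico (recordTime x q) (recordTime x (q + 1)), f t =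
      ∑ t ∈ Finset.range (recordTime x n), f t := by
  induction n with
  | zero => simp [recordTime]
  | succ n ih =>
    rw [Finset.sum_range_succ, ih, Finset.range_eq_Ico, Finset.range_eq_Ico]
    exact Finset.sum_Ico_consecutive f (Nat.zero_le _)
      (recordTime_succ_mem hx (lt_of_lt_recordTime hx n)).1.le

theorem RecordSample.v_eq {n : ℕ} (t : RecordSample n) (l m : ℕ) :
    t.v l m = ∑ i : Fin n, ((if t.r i = m then 1 else 0) +
      ∑ p : Fin (t.s i), if m ≤ t.r i ∧ t.r i ≤ m + l ∧ t.y i p = m then 1 else 0) := by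
  induction l with
  | zero =>
    rw [RecordSample.v, Finset.sum_range_one, RecordSample.a, if_pos rfl]
    refine Finset.sum_congr rfl fun i _ => congrArg _ (Finset.sum_congr rfl fun p _ => ?_)
    exact if_congr (by omega) rfl rfl
  | succ l ih =>
    rw [RecordSample.v, Finset.sum_range_succ, ← RecordSample.v, ih, RecordSample.a,
      if_neg (Nat.succ_ne_zero l), ← Finset.sum_add_distrib]
    refine Finset.sum_congr rfl fun i _ => ?_
    rw [add_assoc, ← Finset.sum_add_distrib]
    refine congrArg _ (Finset.sum_congr rfl fun p _ => ?_)
    split_ifs <;> omega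

theorem sum_orderEmbOfFin (s : Finset ℕ) (f : ℕ → ℕ) :
    ∑ p : Fin s.card, f (s.orderEmbOfFin rfl p) = ∑ t ∈ s, f t := by
  conv_rhs => rw [← Finset.map_orderEmbOfFin_univ s rfl, Finset.sum_map]
  rfl

/-- After the record `R` opening the block, the previous maximum is `R`, so the visit condition
reads `R ≤ m + l`. As `l ≤ k`, this gives `R < m + (k + 1)`: the near-record window misses no visit.
At the record time itself the level condition is automatic. -/
theorem sum_nearRecordTimes_eq (hx : ∀ c, ∃ t, c < x t) {k l : ℕ} (hl : l ≤ k) (m n : ℕ) :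
    (if x (recordTime x n) = m then 1 else 0) + ∑ t ∈ nearRecordTimes x (k + 1) n,
      (if m ≤ x (recordTime x n) ∧ x (recordTime x n) ≤ m + l ∧ x t = m then 1 else 0) =
    ∑ t ∈ Finset.Ico (recordTime x n) (recordTime x (n + 1)),
      if x t = m ∧ ∀ s < t, x s ≤ m + l then 1 else 0 := by
  classical
  have hrec := lt_of_lt_recordTime hx n
  rw [← Finset.Ioo_insert_left (recordTime_succ_mem hx hrec).1,
    Finset.sum_insert Finset.left_notMem_Ioo, nearRecordTimes, Finset.sum_filter]
  congr 1
  · refine if_congr (iff_self_and.2 fun h s hs => ?_) rfl rfl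
    have := hrec s hs
    omega
  · refine Finset.sum_congr rfl fun t ht => ?_
    have hmax := partialMax_eq_of_mem_Ioo hx ht
    rw [Finset.mem_Ioo] at ht
    have hle := le_of_lt_recordTime_succ hrec ht.2
    rw [← ite_and]
    refine if_congr ?_ rfl rfl
    rw [IsNearRecord, hmax]
    constructor
    · rintro ⟨_, _, h2, h3⟩
      exact ⟨h3, fun s hs => (le_of_lt_recordTime_succ hrec (hs.trans ht.2)).trans h2⟩
    · rintro ⟨rfl, H⟩
      have := H _ ht.1
      omega

theorem observedSample_v_eq_tildeV (hx : ∀ c, ∃ t, c < x t) {k l m n : ℕ} (hl : l ≤ k)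
    (hn : m + l ≤ record x n) : ((observedSample x k (n + 1)).v l m : ℕ∞) = tildeV x l m := by
  have hv : (observedSample x k (n + 1)).v l m =
      ∑ t ∈ Finset.range (recordTime x (n + 1)),
        if x t = m ∧ ∀ s < t, x s ≤ m + l then 1 else 0 := by
    rw [← sum_range_sum_Ico_recordTime hx, RecordSample.v_eq, Finset.sum_range]
    refine Finset.sum_congr rfl fun q _ => ?_
    rw [← sum_nearRecordTimes_eq hx hl]
    exact congrArg _ (sum_orderEmbOfFin (nearRecordTimes x (k + 1) q) fun t =>
      if m ≤ x (recordTime x q) ∧ x (recordTime x q) ≤ m + l ∧ x t = m then 1 else 0)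
  rw [hv, ← Finset.card_filter, tildeV_eq_visits, visits, ← Set.encard_coe_eq_coe_finsetCard]
  congr 1
  ext t
  simp only [Finset.coe_filter, Finset.mem_range, Set.mem_ofPred_eq, and_iff_right_iff_imp]
  rintro ⟨ht, H⟩
  have hlt := (recordTime_succ_mem hx (lt_of_lt_recordTime hx n)).2
  rw [record] at hn
  -- The next record exceeds `m + l`: it is not a visit to `m` itself, and it rules out every later
  -- visit.
  by_contra! hge
  rcases hge.lt_or_eq with h | rfl
  · exact absurd (H _ h) (by omega)
  · omega

end Records

end DeltaRecord

theorem mainTheorem2 {Ω : Type*} [MeasurableSpace Ω] (μ : Measure Ω) [IsProbabilityMeasure μ]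
    (X : ℕ → Ω → ℕ) (hmeas : ∀ n, Measurable (X n)) (hindep : iIndepFun X μ)
    (hident : ∀ n, IdentDistrib (X n) (X 0) μ μ)
    (hsupp : {i : ℕ | DeltaRecord.pmf μ (X 0) i ≠ 0}.Infinite) (j k : ℕ) :
    DeltaRecord.IsGeomStar μ
      (fun ω (i : Fin (k + 1)) =>
        DeltaRecord.tildeV (fun n => X n ω) (k - (i : ℕ)) (j + (i : ℕ)))
      (fun i : Fin (k + 1) => DeltaRecord.condHazard μ (X 0) (j + (i : ℕ)) j) ∧
    ∀ᵐ ω ∂μ, ∀ n : ℕ,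
      j + k ≤ (DeltaRecord.observedSample (fun n => X n ω) k (n + 1)).r (Fin.last n) →
      ∀ i : Fin (k + 1),
        ((DeltaRecord.observedSample (fun n => X n ω) k (n + 1)).v
            (k - (i : ℕ)) (j + (i : ℕ)) : ℕ∞) =
          DeltaRecord.tildeV (fun n => X n ω) (k - (i : ℕ)) (j + (i : ℕ)) := by

  refine ⟨DeltaRecord.isGeomStar_tildeV hmeas hindep hident hsupp j k, ?_⟩
  filter_upwards [DeltaRecord.ae_exists_lt hmeas hindep hident hsupp] with ω hω n hn i
  refine DeltaRecord.observedSample_v_eq_tildeV hω (n := n) (Nat.sub_le k i) ?_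
  have hn' : j + k ≤ DeltaRecord.record (fun n => X n ω) n := hn
  omega
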